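/- All graphs are finite and simple. A snark is a connected bridgeless cubic graph that has no proper 3-edge-coloring. A proper $\mathbb{Z}_4\times\mathbb{Z}_2$-coloring of a cubic graph $G$ is a proper edge-coloring of $G$ by non-zero elements of $\mathbb{Z}_4\times\mathbb{Z}_2$ such that the colors of the three edges incident to any vertex sum to zero. Let $G$ be a snark, $F$ a $2$-factor of $G$ (a spanning $2$-regular subgraph), $M\subseteq E(F)$ a matching, and $H=G-M$ the graph obtained by deleting the edges of $M$. Vertices of degree $k$ in $H$ are called $k$-vertices. An $F$-path in $H$ is a path with at least one edge whose end-vertices are $3$-vertices of $H$, whose interior vertices are $2$-vertices of $H$, and whose end-edges (the edges incident to an end-vertex of the path) belong to $F$. An $F$-matching of $H$ is a collection $\mathcal{P}$ of vertex-disjoint $F$-paths in $H$ such that every $3$-vertex of $H$ lies on precisely one of them. The $F$-complement of $\mathcal{P}$ is the subgraph of $H$ induced by all edges of $H$ not contained in paths of $\mathcal{P}$; it is a disjoint union of cycles, called loops, and $\mathcal{L}$ denotes the set of loops. A loop is $3$-odd if it contains an odd number of $3$-vertices of $H$. Let $\mathcal{C}^{*}$ be the set of connected components of $F-E_{\mathcal{P}}$,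 where $E_{\mathcal{P}}$ is the set of all end-edges of paths of $\mathcal{P}$. The loop-cycle-incidence graph $B$ of $\mathcal{P}$ is the bipartite graph with vertex set $\mathcal{C}^{*}\cup(\mathcal{L}\cup\mathcal{P})$ in which $X\in\mathcal{L}\cup\mathcal{P}$ is adjacent to $C\in\mathcal{C}^{*}$ if and only if $X$ and $C$ share an edge; $B-\mathcal{P}$ is obtained from $B$ by deleting all vertices belonging to $\mathcal{P}$. **Theorem.** Let $G$ be a snark, $F$ a $2$-factor of $G$, $M$ a matching in $F$, and $\mathcal{P}$ an $F$-matching of $H=G-M$ with loop-cycle-incidence graph $B$. If every connected component of $B-\mathcal{P}$ contains an even number of $3$-odd loops, then $G$ has a proper $\mathbb{Z}_4\times\mathbb{Z}_2$-coloring. -/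

import Mathlib

namespace SnarkColoring

variable {V : Type*}

/-- Every vertex of `G` has degree `k`. -/
def IsRegular (G : SimpleGraph V) (k : ℕ) : Prop :=
  ∀ v, (G.neighborSet v).ncard = k

/-- A snark: a connected bridgeless cubic graph with no proper 3-edge-coloring (a proper
edge-coloring of `G` is a proper vertex coloring of its line graph). -/
structure IsSnark (G : SimpleGraph V) : Prop where
  connected : G.Connected
  cubic : IsRegular G 3
  bridgeless : ∀ e ∈ G.edgeSet, ¬ G.IsBridge e
  not_three_edge_colorable : ¬ G.lineGraph.Colorable 3

/-- `G` has a proper `A`-coloring: a proper edge-coloring by non-zero elements of `A` such that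
the colors of the edges incident to any vertex add up to zero. -/
def HasProperAbelianColoring (G : SimpleGraph V) (A : Type*) [AddCommGroup A] : Prop :=
  ∃ σ : G.lineGraph.Coloring A,
    (∀ e : G.edgeSet, σ e ≠ 0) ∧
    ∀ v : V, ∑ᶠ e : G.incidenceSet v, σ ⟨e.1, e.2.1⟩ = 0

/-- `F` is a 2-factor of `G`: a spanning subgraph in which all degrees are 2. -/
def IsTwoFactor (G F : SimpleGraph V) : Prop :=
  F ≤ G ∧ IsRegular F 2

/-- `v` is a `k`-vertex of `H`. -/
def IsKVertex (H : SimpleGraph V) (k : ℕ) (v : V) : Prop :=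
  (H.neighborSet v).ncard = k

section

variable {H : SimpleGraph V}

/-- The subgraph `P` of `H` is a path with at least one edge. -/
def IsPathSubgraph (P : H.Subgraph) : Prop :=
  ∃ (u v : V) (p : H.Walk u v), p.IsPath ∧ 0 < p.length ∧ p.toSubgraph = P

/-- The subgraph `C` of `H` is a cycle. -/
def IsCycleSubgraph (C : H.Subgraph) : Prop :=
  ∃ (u : V) (p : H.Walk u u), p.IsCycle ∧ p.toSubgraph = C

/-- `v` is an end-vertex of the path `P`: a vertex of `P` of degree 1 in `P`. -/
def IsEndVertex (P : H.Subgraph) (v : V) : Prop :=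
  v ∈ P.verts ∧ (P.neighborSet v).ncard = 1

/-- The end-edges of the path `P`: its edges that are incident to an end-vertex of `P`. -/
def endEdges (P : H.Subgraph) : Set (Sym2 V) :=
  {e | e ∈ P.edgeSet ∧ ∃ v ∈ e, IsEndVertex P v}

/-- `F`-paths in `H`. -/
structure IsFPath (F : SimpleGraph V) (P : H.Subgraph) : Prop where
  isPath : IsPathSubgraph P
  end_vertices : ∀ v ∈ P.verts, IsEndVertex P v → IsKVertex H 3 v
  interior_vertices : ∀ v ∈ P.verts, ¬ IsEndVertex P v → IsKVertex H 2 v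
  end_edges : ∀ e ∈ endEdges P, e ∈ F.edgeSet

/-- `F`-matchings of `H`: collections of vertex-disjoint `F`-paths in `H` such that every
3-vertex of `H` is on precisely one of them. -/
structure IsFMatching (F : SimpleGraph V) (𝓟 : Set H.Subgraph) : Prop where
  isFPath : ∀ P ∈ 𝓟, IsFPath F P
  disjoint : ∀ P ∈ 𝓟, ∀ Q ∈ 𝓟, P ≠ Q → Disjoint P.verts Q.verts
  covers : ∀ v, IsKVertex H 3 v → ∃! P, P ∈ 𝓟 ∧ v ∈ P.verts

/-- The `F`-complement of `𝓟`: the subgraph of `H` induced by all edges of `H` that are not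
contained in the paths of `𝓟`. -/
def fComplement (𝓟 : Set H.Subgraph) : H.Subgraph where
  verts := {v | ∃ w, H.Adj v w ∧ ∀ P ∈ 𝓟, ¬ P.Adj v w}
  Adj v w := H.Adj v w ∧ ∀ P ∈ 𝓟, ¬ P.Adj v w
  adj_sub h := h.1
  edge_vert h := ⟨_, h⟩
  symm := ⟨fun _ _ h => ⟨h.1.symm, fun P hP hPvw => h.2 P hP hPvw.symm⟩⟩

/-- The loops: the cycles of the `F`-complement. -/
def loops (𝓟 : Set H.Subgraph) : Set H.Subgraph :=
  {L | IsCycleSubgraph L ∧ L ≤ fComplement 𝓟}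

/-- A loop is 3-odd if it contains an odd number of 3-vertices of `H`. -/
def IsThreeOdd (L : H.Subgraph) : Prop :=
  Odd {v | v ∈ L.verts ∧ IsKVertex H 3 v}.ncard

/-- The graph `F - E_𝓟`, where `E_𝓟` is the set of all end-edges of paths of `𝓟`. -/
def cutFactor (F : SimpleGraph V) (𝓟 : Set H.Subgraph) : SimpleGraph V :=
  F.deleteEdges (⋃ P ∈ 𝓟, endEdges P)

/-- The vertices of the loop-cycle-incidence graph: the connected components of `F - E_𝓟`, the
loops, and the paths of `𝓟`. -/
inductive LCVertex (F : SimpleGraph V) (𝓟 : Set H.Subgraph)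
  | component (C : (cutFactor F 𝓟).ConnectedComponent)
  | loop (L : loops 𝓟)
  | path (P : 𝓟)

/-- A component `C` of `F - E_𝓟` and a subgraph `L` of `H` share an edge. -/
def ShareEdge (F : SimpleGraph V) (𝓟 : Set H.Subgraph)
    (C : (cutFactor F 𝓟).ConnectedComponent) (L : H.Subgraph) : Prop :=
  (C.toSubgraph.edgeSet ∩ L.edgeSet).Nonempty

/-- Incidence of a loop or a path with a component of `F - E_𝓟`. -/
def LCVertex.Incident {F : SimpleGraph V} {𝓟 : Set H.Subgraph} :
    LCVertex F 𝓟 → LCVertex F 𝓟 → Prop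
  | .loop L, .component C => ShareEdge F 𝓟 C L.1
  | .path P, .component C => ShareEdge F 𝓟 C P.1
  | _, _ => False

/-- The loop-cycle-incidence graph `B`. -/
def loopCycleGraph (F : SimpleGraph V) (𝓟 : Set H.Subgraph) : SimpleGraph (LCVertex F 𝓟) where
  Adj x y := x.Incident y ∨ y.Incident x
  symm := ⟨fun _ _ h => h.symm⟩
  loopless := ⟨fun x h => by cases x <;> exact h.elim id id⟩

/-- The graph `B - 𝓟`: all vertices of `B` that are paths of `𝓟` are removed. -/
def loopCycleGraphMinusPaths (F : SimpleGraph V) (𝓟 : Set H.Subgraph) :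
    SimpleGraph ((Set.range (LCVertex.path (F := F) (𝓟 := 𝓟)))ᶜ : Set (LCVertex F 𝓟)) :=
  (loopCycleGraph F 𝓟).induce (Set.range LCVertex.path)ᶜ

end

end SnarkColoring

/-! The second coordinate of a color is the indicator of `F`; the first is odd exactly on the edges
of loops. Every vertex meets two edges of `F` and zero or two loop edges, so only the lift of the
first coordinate from `ZMod 2` to `ZMod 4` has to be chosen. It is encoded by two chains over `ZMod
2`: `s` on `F - E_𝓟` governs the values 0 and 2 on `F`-edges outside the loops, and `g` governs the
values 1 and 3 on loop edges; edges outside both `F` and the loops get `(2, 0)`.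

At interior vertices of paths, zero sum means that `s` has zero boundary. At loop vertices it
prescribes the boundary of `g`. As loops are connected, `g` exists as soon as the prescribed values
add up to zero on each loop, which says that the boundary of `s` sums over each loop to the parity
of its number of 3-vertices (`exists_fComplement_chain`).

Such an `s` exists (`exists_cutFactor_chain`): a path in a component of `F - E_𝓟` between two loops
meeting it flips the sums of just these two loops. Hence every even set of loops within a component
of `B - 𝓟` can be flipped, in particular its 3-odd loops. -/

namespace SnarkColoring

variable {V : Type*}

/-! ### Chains and boundaries over `ZMod 2`. -/

/-- If a subspace contains `single i + single j` for all equivalent `i`, `j`, then it contains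
every vector whose entries add up to zero on each equivalence class. -/
lemma mem_of_sum_class_eq_zero {ι : Type*} [Fintype ι] [DecidableEq ι]
    (A : Submodule (ZMod 2) (ι → ZMod 2)) (r : Setoid ι) [DecidableRel r]
    (hA : ∀ i j, r i j → (Pi.single i 1 + Pi.single j 1 : ι → ZMod 2) ∈ A)
    (d : ι → ZMod 2) (hd : ∀ i, ∑ j with r i j, d j = 0) : d ∈ A := by
  classical
  let rep : ι → ι := fun i => (Quotient.mk r i).out
  have hrep : ∀ i, r i (rep i) := fun i => r.symm (Quotient.mk_out (s := r) i)
  -- The coefficient at a representative is its class sum, which is zero; all other coefficients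
  -- vanish trivially.
  have hzero : ∑ i, d i • (Pi.single (rep i) 1 : ι → ZMod 2) = 0 := by
    ext k
    simp only [Finset.sum_apply, Pi.smul_apply, Pi.single_apply, smul_eq_mul, mul_ite, mul_one,
      mul_zero, Pi.zero_apply, ← Finset.sum_filter]
    by_cases hk : rep k = k
    · rw [← hd k]
      refine Finset.sum_congr (Finset.filter_congr fun i _ => ⟨fun h => ?_, fun h => ?_⟩)
        fun _ _ => rfl
      · rw [h]; exact r.symm (hrep i)
      · rw [← hk]
        exact congrArg Quotient.out (Quotient.sound (s := r) h)
    · rw [Finset.sum_eq_zero]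
      intro i hi
      exfalso
      have h : k = rep i := (Finset.mem_filter.1 hi).2
      refine hk ?_
      rw [h]
      exact congrArg Quotient.out (Quotient.out_eq (Quotient.mk r i))
  have hsum : d = ∑ i, d i • (Pi.single i 1 + Pi.single (rep i) 1 : ι → ZMod 2) := by
    simp only [smul_add, Finset.sum_add_distrib, hzero, add_zero]
    ext k
    simp [Finset.sum_apply, Pi.single_apply]
  rw [hsum]
  exact A.sum_mem fun i _ => A.smul_mem _ (hA _ _ (hrep i))

/-- The boundary over `ZMod 2` of a function on (potential) edges. -/
def boundary (V : Type*) [Fintype V] : (Sym2 V → ZMod 2) →ₗ[ZMod 2] (V → ZMod 2) where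
  toFun s v := ∑ w, s s(v, w)
  map_add' s t := by ext v; simp [Finset.sum_add_distrib]
  map_smul' c s := by ext v; simp [Finset.mul_sum]

lemma boundary_apply [Fintype V] (s : Sym2 V → ZMod 2) (v : V) :
    boundary V s v = ∑ w, s s(v, w) := rfl

/-- The functions supported on the edges of `K`. -/
def edgeChains (K : SimpleGraph V) : Submodule (ZMod 2) (Sym2 V → ZMod 2) where
  carrier := {s | ∀ v w, ¬ K.Adj v w → s s(v, w) = 0}
  add_mem' ha hb v w h := by simp [ha v w h, hb v w h]
  zero_mem' _ _ _ := rfl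
  smul_mem' c s hs v w h := by simp [hs v w h]

/-- No edge leaves `S`, and each edge inside `S` is counted once from either end. Diagonal terms
vanish because `K` has no loops. -/
lemma sum_boundary_eq_zero [Fintype V] {K : SimpleGraph V} {s : Sym2 V → ZMod 2}
    (hs : s ∈ edgeChains K) (S : Finset V) (hS : ∀ v ∈ S, ∀ w, K.Adj v w → w ∈ S) :
    ∑ v ∈ S, boundary V s v = 0 := by
  classical
  have h : ∀ v ∈ S, boundary V s v = ∑ w ∈ S, s s(v, w) := fun v hv =>
    (Finset.sum_subset (Finset.subset_univ S) fun w _ hw => hs v w fun h => hw (hS v hv w h)).symm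
  rw [Finset.sum_congr rfl h, ← Finset.sum_product']
  refine Finset.sum_involution (fun p _ => p.swap) ?_ ?_ ?_ ?_
  · rintro ⟨a, b⟩ _
    simp only [Prod.fst_swap, Prod.snd_swap, Sym2.eq_swap (a := b)]
    exact CharTwo.add_self_eq_zero _
  · rintro ⟨a, b⟩ _ hne heq
    have : b = a := congrArg Prod.fst heq
    subst this
    exact hne (hs b b (K.loopless.irrefl b))
  · rintro ⟨a, b⟩ hab
    simpa [and_comm] using hab
  · rintro ⟨a, b⟩ _
    rfl

/-- The edges of a walk from `v` to `w` telescope modulo 2. -/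
lemma single_add_single_mem_map_boundary [Fintype V] [DecidableEq V] {K : SimpleGraph V} {v w : V}
    (h : K.Reachable v w) :
    (Pi.single v 1 + Pi.single w 1 : V → ZMod 2) ∈ (edgeChains K).map (boundary V) := by
  obtain ⟨p⟩ := h
  induction p with
  | nil => rw [ZModModule.add_self]; exact Submodule.zero_mem _
  | @cons a b c hab _ ih =>
    have h1 : (Pi.single a 1 + Pi.single b 1 : V → ZMod 2) ∈ (edgeChains K).map (boundary V) := by
      refine ⟨Pi.single s(a, b) 1, fun x y hxy => Pi.single_eq_of_ne ?_ _, ?_⟩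
      · intro h
        rw [← SimpleGraph.mem_edgeSet, h] at hxy
        exact hxy hab
      · ext x
        have hne := hab.ne
        simp only [boundary_apply, Pi.single_apply, Sym2.eq_iff, Pi.add_apply]
        by_cases hxa : x = a
        · subst hxa; simp [hne]
        · by_cases hxb : x = b
          · subst hxb; simp [hxa]
          · simp [hxa, hxb]
    have := Submodule.add_mem _ h1 ih
    rwa [add_assoc, ← add_assoc (Pi.single b 1), ZModModule.add_self, zero_add] at this

lemma mem_map_boundary [Fintype V] (K : SimpleGraph V) [DecidableRel K.Reachable] (T : V → ZMod 2)
    (hT : ∀ v, ∑ w with K.Reachable v w, T w = 0) : T ∈ (edgeChains K).map (boundary V) := by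
  classical
  exact mem_of_sum_class_eq_zero _ K.reachableSetoid
    (fun _ _ h => single_add_single_mem_map_boundary h) T (fun v => by convert hT v; rfl)

end SnarkColoring

/-! ### Local structure at a vertex. -/

namespace SnarkColoring

variable {V : Type*}

lemma IsPathSubgraph.ncard_neighborSet_eq_two {H : SimpleGraph V} {P : H.Subgraph}
    (hP : IsPathSubgraph P) {v : V} (hv : v ∈ P.verts) (hend : ¬ IsEndVertex P v) :
    (P.neighborSet v).ncard = 2 := by
  obtain ⟨a, b, p, hp, hpos, rfl⟩ := hP
  have hnil : ¬ p.Nil := fun h => hpos.ne' (SimpleGraph.Walk.length_eq_zero_iff.2 h)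
  obtain ⟨i, rfl, hi⟩ := SimpleGraph.Walk.mem_support_iff_exists_getVert.1
    (p.mem_verts_toSubgraph.1 hv)
  by_cases h0 : i = 0
  · refine absurd ⟨hv, ?_⟩ hend
    rw [h0, p.getVert_zero, hp.neighborSet_toSubgraph_startpoint hnil, Set.ncard_singleton]
  · by_cases h1 : i = p.length
    · refine absurd ⟨hv, ?_⟩ hend
      rw [h1, p.getVert_length, hp.neighborSet_toSubgraph_endpoint hnil, Set.ncard_singleton]
    · exact hp.ncard_neighborSet_toSubgraph_internal_eq_two h0 (lt_of_le_of_ne hi h1)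

section Factor

variable {G F : SimpleGraph V}

/-- The neighbors of `v` in `G` are `x`, `y` and `z`, those in the 2-factor `F` are `x` and `y`. -/
structure IsStar (G F : SimpleGraph V) (v x y z : V) : Prop where
  ne_xy : x ≠ y
  ne_xz : x ≠ z
  ne_yz : y ≠ z
  adj_iff : ∀ w, G.Adj v w ↔ w = x ∨ w = y ∨ w = z
  factor_adj_iff : ∀ w, F.Adj v w ↔ w = x ∨ w = y

lemma exists_isStar [Finite V] (hG : IsRegular G 3) (hF : IsTwoFactor G F) {v x : V}
    (hx : F.Adj v x) : ∃ y z, IsStar G F v x y z := by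
  have hsub : F.neighborSet v ⊆ G.neighborSet v := fun w hw => hF.1 hw
  obtain ⟨y, hy⟩ : ∃ y, F.neighborSet v \ {x} = {y} := by
    rw [← Set.ncard_eq_one, Set.ncard_sdiff_singleton_of_mem (s := F.neighborSet v) hx, hF.2 v]
  obtain ⟨z, hz⟩ : ∃ z, G.neighborSet v \ F.neighborSet v = {z} := by
    rw [← Set.ncard_eq_one, Set.ncard_sdiff hsub, hG v, hF.2 v]
  have hy' : ∀ w, F.Adj v w ∧ w ≠ x ↔ w = y := fun w => by simpa using Set.ext_iff.1 hy w
  have hz' : ∀ w, G.Adj v w ∧ ¬ F.Adj v w ↔ w = z := fun w => by simpa using Set.ext_iff.1 hz w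
  have hyF := (hy' y).2 rfl
  have hzF := (hz' z).2 rfl
  refine ⟨y, z, hyF.2.symm, ?_, ?_, fun w => ?_, fun w => ?_⟩
  · rintro rfl; exact hzF.2 hx
  · rintro rfl; exact hzF.2 hyF.1
  · constructor
    · intro h
      rw [← hy', ← hz']
      tauto
    · rintro (rfl | rfl | rfl)
      exacts [hF.1 hx, hF.1 hyF.1, hzF.1]
  · constructor
    · intro h
      rw [← hy']
      tauto
    · rintro (rfl | rfl)
      exacts [hx, hyF.1]

end Factor

variable {G F H : SimpleGraph V} {M : F.Subgraph} {𝓟 : Set H.Subgraph}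

/-- The position of a vertex `v` with respect to the paths and loops: `v` is the end of a path, lies
on a loop and is matched by `M`, or is an interior vertex of a path. -/
lemma exists_isStar_cases [Finite V] (hG : IsRegular G 3) (hF : IsTwoFactor G F)
    (hM : M.IsMatching) (hH : ∀ v w, H.Adj v w ↔ G.Adj v w ∧ ¬ M.Adj v w)
    (h𝓟 : IsFMatching F 𝓟) (v : V) :
    ∃ x y z, IsStar G F v x y z ∧
      ((IsKVertex H 3 v ∧ H.Adj v x ∧
          (∀ w, (fComplement 𝓟).Adj v w ↔ w = y ∨ w = z) ∧ ¬ (cutFactor F 𝓟).Adj v x) ∨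
        (¬ IsKVertex H 3 v ∧ ¬ H.Adj v x ∧
          (∀ w, (fComplement 𝓟).Adj v w ↔ w = y ∨ w = z)) ∨
        ((∀ w, ¬ (fComplement 𝓟).Adj v w) ∧ ¬ H.Adj v x ∧
          H.Adj v y ∧ H.Adj v z)) := by
  have hHadj := hH v
  have hD : ∀ w, (fComplement 𝓟).Adj v w ↔ H.Adj v w ∧ ∀ P ∈ 𝓟, ¬ P.Adj v w := fun w => Iff.rfl
  by_cases hv : v ∈ M.verts
  · obtain ⟨x, hx, hxu⟩ := hM hv
    obtain ⟨y, z, hs⟩ := exists_isStar hG hF (M.adj_sub hx)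
    have hMx : ∀ w, M.Adj v w ↔ w = x := fun w => ⟨hxu w, fun h => h ▸ hx⟩
    have hHyz : ∀ w, H.Adj v w ↔ w = y ∨ w = z := fun w => by
      rw [hHadj, hs.adj_iff, hMx]
      have := hs.ne_xy; have := hs.ne_xz
      constructor
      · tauto
      · rintro (rfl | rfl) <;> tauto
    have hcard : (H.neighborSet v).ncard = 2 := by
      have : H.neighborSet v = {y, z} := by ext w; simp [hHyz]
      rw [this, Set.ncard_pair hs.ne_yz]
    have h3 : ¬ IsKVertex H 3 v := fun h => by
      have h : (H.neighborSet v).ncard = 3 := h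
      omega
    have hnx : ¬ H.Adj v x := fun h => ((hHadj x).1 h).2 hx
    refine ⟨x, y, z, hs, Or.inr ?_⟩
    by_cases hP : ∃ P ∈ 𝓟, v ∈ P.verts
    · obtain ⟨P, hP, hvP⟩ := hP
      right
      refine ⟨fun w hw => ?_, hnx, (hHyz y).2 (Or.inl rfl), (hHyz z).2 (Or.inr rfl)⟩
      have hend : ¬ IsEndVertex P v := fun h => h3 ((h𝓟.isFPath P hP).end_vertices v hvP h)
      have h2 := (h𝓟.isFPath P hP).isPath.ncard_neighborSet_eq_two hvP hend
      -- The two path edges at `v` exhaust its edges in `H`, so no edge at `v` is left for the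
      -- `F`-complement.
      have heq : P.neighborSet v = H.neighborSet v :=
        Set.eq_of_subset_of_ncard_le (P.neighborSet_subset v) (by omega) (Set.toFinite _)
      have : w ∈ P.neighborSet v := by rw [heq]; exact hw.1
      exact hw.2 P hP this
    · left
      refine ⟨h3, hnx, fun w => ?_⟩
      rw [hD, hHyz]
      exact and_iff_left fun P hPm hadj => hP ⟨P, hPm, P.edge_vert hadj⟩
  · have hHG : ∀ w, H.Adj v w ↔ G.Adj v w := fun w => by
      rw [hHadj]
      exact and_iff_left fun h => hv (M.edge_vert h)
    have h3 : IsKVertex H 3 v := by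
      have : H.neighborSet v = G.neighborSet v := by ext w; simp [hHG]
      exact (congrArg Set.ncard this).trans (hG v)
    obtain ⟨P, ⟨hP, hvP⟩, hPu⟩ := h𝓟.covers v h3
    have hend : IsEndVertex P v := by
      by_contra hend
      have h2 : (H.neighborSet v).ncard = 2 := (h𝓟.isFPath P hP).interior_vertices v hvP hend
      have h3 : (H.neighborSet v).ncard = 3 := h3
      omega
    obtain ⟨x, hx⟩ := Set.ncard_eq_one.1 hend.2
    have hPx : ∀ w, P.Adj v w ↔ w = x := fun w => by simpa using Set.ext_iff.1 hx w
    have hxP := (hPx x).2 rfl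
    have hxE : s(v, x) ∈ endEdges P := ⟨hxP, v, Sym2.mem_mk_left v x, hend⟩
    obtain ⟨y, z, hs⟩ := exists_isStar hG hF ((h𝓟.isFPath P hP).end_edges _ hxE)
    refine ⟨x, y, z, hs, Or.inl ⟨h3, P.adj_sub hxP, fun w => ?_, fun h => ?_⟩⟩
    · have hall : (∀ Q ∈ 𝓟, ¬ Q.Adj v w) ↔ w ≠ x := by
        rw [ne_eq, ← hPx w]
        refine ⟨fun h => h P hP, fun h Q hQ hadj => h ?_⟩
        rwa [← hPu Q ⟨hQ, Q.edge_vert hadj⟩]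
      rw [hD, hall, hHG, hs.adj_iff]
      have := hs.ne_xy; have := hs.ne_xz
      constructor
      · tauto
      · rintro (rfl | rfl) <;> tauto
    · rw [cutFactor, SimpleGraph.deleteEdges_adj] at h
      exact h.2 (Set.mem_biUnion hP hxE)

/-! ### Loops are the nontrivial components of the `F`-complement. -/

section Loops

/-- A loop already has degree 2 at `v`, which is all the degree available in the `F`-complement. -/
lemma loops.adj_iff (hD : (fComplement 𝓟).spanningCoe.IsCycles) [Finite V] {L : H.Subgraph}
    (hL : L ∈ loops 𝓟) {v : V} (hv : v ∈ L.verts) (w : V) :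
    L.Adj v w ↔ (fComplement 𝓟).Adj v w := by
  obtain ⟨⟨u, p, hp, rfl⟩, hle⟩ := hL
  have h2 := hp.ncard_neighborSet_toSubgraph_eq_two (p.mem_verts_toSubgraph.1 hv)
  have hsub : p.toSubgraph.neighborSet v ⊆ (fComplement 𝓟).spanningCoe.neighborSet v :=
    fun w hw => hle.2 hw
  have hne : ((fComplement 𝓟).spanningCoe.neighborSet v).Nonempty :=
    (Set.nonempty_of_ncard_ne_zero (by omega)).mono hsub
  have heq := Set.eq_of_subset_of_ncard_le hsub (by rw [hD hne]; omega) (Set.toFinite _)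
  exact Set.ext_iff.1 heq w

lemma loops.exists_adj {L : H.Subgraph} (hL : L ∈ loops 𝓟) {v : V} (hv : v ∈ L.verts) :
    ∃ w, (fComplement 𝓟).Adj v w := by
  obtain ⟨⟨u, p, hp, rfl⟩, hle⟩ := hL
  have h2 := hp.ncard_neighborSet_toSubgraph_eq_two (p.mem_verts_toSubgraph.1 hv)
  obtain ⟨w, hw⟩ := Set.nonempty_of_ncard_ne_zero
    (s := p.toSubgraph.neighborSet v) (by omega)
  exact ⟨w, hle.2 hw⟩

lemma loops.mem_verts_iff (hD : (fComplement 𝓟).spanningCoe.IsCycles) [Finite V] {L : H.Subgraph}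
    (hL : L ∈ loops 𝓟) {v : V} (hv : v ∈ L.verts) (w : V) :
    w ∈ L.verts ↔ (fComplement 𝓟).spanningCoe.Reachable v w := by
  constructor
  · intro hw
    obtain ⟨⟨u, p, hp, rfl⟩, hle⟩ := hL
    have hreach := (p.toSubgraph_connected).preconnected ⟨v, hv⟩ ⟨w, hw⟩
    exact hreach.map (G' := (fComplement 𝓟).spanningCoe) ⟨Subtype.val, fun h => hle.2 h⟩
  · rintro ⟨q⟩
    induction q with
    | nil => exact hv
    | cons h _ ih =>
      have h : (fComplement 𝓟).Adj _ _ := h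
      exact ih (((loops.adj_iff hD hL hv _).2 h).snd_mem)

lemma loops.eq_of_mem_verts (hD : (fComplement 𝓟).spanningCoe.IsCycles) [Finite V]
    {L L' : H.Subgraph} (hL : L ∈ loops 𝓟) (hL' : L' ∈ loops 𝓟) {v : V} (hv : v ∈ L.verts)
    (hv' : v ∈ L'.verts) : L = L' := by
  have hverts : L.verts = L'.verts := by
    ext w
    rw [loops.mem_verts_iff hD hL hv, loops.mem_verts_iff hD hL' hv']
  refine SimpleGraph.Subgraph.ext hverts ?_
  ext a b
  constructor
  · intro h
    have ha := L.edge_vert h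
    rw [loops.adj_iff hD hL ha] at h
    rwa [loops.adj_iff hD hL' (hverts ▸ ha)]
  · intro h
    have ha := L'.edge_vert h
    rw [loops.adj_iff hD hL' ha] at h
    rwa [loops.adj_iff hD hL (hverts ▸ ha)]

/-- A nontrivial component of a finite graph with all degrees 0 or 2 is a cycle; this cycle is
transferred to `H`. -/
lemma loops.exists_mem_verts (hD : (fComplement 𝓟).spanningCoe.IsCycles) [Finite V] {v w : V}
    (h : (fComplement 𝓟).Adj v w) : ∃ L ∈ loops 𝓟, v ∈ L.verts := by
  obtain ⟨p, hp, -⟩ := hD.exists_cycle_toSubgraph_verts_eq_connectedComponentSupp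
    (c := (fComplement 𝓟).spanningCoe.connectedComponentMk v) rfl ⟨w, h⟩
  have hle : (fComplement 𝓟).spanningCoe ≤ H := (fComplement 𝓟).spanningCoe_le
  have hadj : ∀ a b, (p.mapLe hle).toSubgraph.Adj a b → (fComplement 𝓟).Adj a b := by
    intro a b hab
    rw [← SimpleGraph.Subgraph.mem_edgeSet, SimpleGraph.Walk.mem_edges_toSubgraph,
      SimpleGraph.Walk.edges_mapLe_eq_edges] at hab
    exact p.adj_of_mem_edges hab
  have hcyc : (p.mapLe hle).IsCycle := hp.mapLe hle
  refine ⟨(p.mapLe hle).toSubgraph, ⟨⟨v, _, hcyc, rfl⟩, ⟨fun a ha => ?_, fun a b => hadj a b⟩⟩, ?_⟩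
  · have h2 := hcyc.ncard_neighborSet_toSubgraph_eq_two
      ((p.mapLe hle).mem_verts_toSubgraph.1 ha)
    obtain ⟨b, hb⟩ := Set.nonempty_of_ncard_ne_zero
      (s := (p.mapLe hle).toSubgraph.neighborSet a) (by omega)
    exact ⟨b, hadj a b hb⟩
  · exact (p.mapLe hle).start_mem_verts_toSubgraph

end Loops

lemma isCycles_fComplement [Finite V] (hG : IsRegular G 3) (hF : IsTwoFactor G F)
    (hM : M.IsMatching) (hH : ∀ v w, H.Adj v w ↔ G.Adj v w ∧ ¬ M.Adj v w)
    (h𝓟 : IsFMatching F 𝓟) : (fComplement 𝓟).spanningCoe.IsCycles := by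
  rintro v ⟨u, hu⟩
  obtain ⟨x, y, z, hs, h⟩ := exists_isStar_cases hG hF hM hH h𝓟 v
  have key : (∀ w, (fComplement 𝓟).Adj v w ↔ w = y ∨ w = z) →
      ((fComplement 𝓟).spanningCoe.neighborSet v).ncard = 2 := fun h => by
    have : (fComplement 𝓟).spanningCoe.neighborSet v = {y, z} := by ext w; simp [h]
    rw [this, Set.ncard_pair hs.ne_yz]
  rcases h with ⟨-, -, h, -⟩ | ⟨-, -, h⟩ | ⟨h, -⟩
  · exact key h
  · exact key h
  · exact absurd hu (h u)

end SnarkColoring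

/-! ### Construction of the chain `s` on `F - E_𝓟`. -/

namespace SnarkColoring

variable {V : Type*} {F H : SimpleGraph V} {𝓟 : Set H.Subgraph}

/-- Sums of a function on the vertices over the vertex sets of the loops. -/
def loopSum [Fintype V] (𝓟 : Set H.Subgraph) [∀ L : loops 𝓟, DecidablePred (· ∈ L.1.verts)] :
    (V → ZMod 2) →ₗ[ZMod 2] (loops 𝓟 → ZMod 2) where
  toFun T L := ∑ v with v ∈ L.1.verts, T v
  map_add' s t := by ext v; simp [Finset.sum_add_distrib]
  map_smul' c s := by ext v; simp [Finset.mul_sum]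

/-- A loop as a vertex of the loop-cycle-incidence graph without paths. -/
def loopVertex (F : SimpleGraph V) (L : loops 𝓟) :
    ((Set.range (LCVertex.path (F := F) (𝓟 := 𝓟)))ᶜ : Set (LCVertex F 𝓟)) :=
  ⟨.loop L, by rintro ⟨P, hP⟩; cases hP⟩

lemma loopVertex_injective : Function.Injective (loopVertex (𝓟 := 𝓟) F) := fun _ _ h =>
  LCVertex.loop.inj (congrArg Subtype.val h)

lemma exists_mem_of_shareEdge {C : (cutFactor F 𝓟).ConnectedComponent} {L : H.Subgraph}
    (h : ShareEdge F 𝓟 C L) : ∃ a ∈ L.verts, (cutFactor F 𝓟).connectedComponentMk a = C := by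
  obtain ⟨e, heC, heL⟩ := h
  induction e using Sym2.ind with
  | _ a b => exact ⟨a, L.edge_vert heL, C.toSubgraph.edge_vert heC⟩

/-- If a submodule contains `single L + single L'` whenever the loops `L` and `L'` share edges with
the same component of `F - E_𝓟`, then it does so for all `L`, `L'` connected in `B - 𝓟`. -/
lemma single_add_single_mem_of_reachable [DecidableEq (loops 𝓟)]
    (A : Submodule (ZMod 2) (loops 𝓟 → ZMod 2))
    (hA : ∀ (C : (cutFactor F 𝓟).ConnectedComponent) (L L' : loops 𝓟), ShareEdge F 𝓟 C L.1 →
      ShareEdge F 𝓟 C L'.1 → (Pi.single L 1 + Pi.single L' 1 : loops 𝓟 → ZMod 2) ∈ A)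
    {L L' : loops 𝓟}
    (h : (loopCycleGraphMinusPaths F 𝓟).Reachable (loopVertex F L) (loopVertex F L')) :
    (Pi.single L 1 + Pi.single L' 1 : loops 𝓟 → ZMod 2) ∈ A := by
  have htrans : ∀ L₁ L₂ L₃ : loops 𝓟, (Pi.single L₁ 1 + Pi.single L₂ 1 : loops 𝓟 → ZMod 2) ∈ A →
      (Pi.single L₂ 1 + Pi.single L₃ 1 : loops 𝓟 → ZMod 2) ∈ A →
      (Pi.single L₁ 1 + Pi.single L₃ 1 : loops 𝓟 → ZMod 2) ∈ A := by
    intro L₁ L₂ L₃ h₁ h₂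
    have := A.add_mem h₁ h₂
    rwa [add_assoc, ← add_assoc (Pi.single L₂ 1), ZModModule.add_self, zero_add] at this
  -- Walks alternate between loops and components, so the induction needs a claim at components too:
  -- it speaks of all loops meeting the component.
  let Q : LCVertex F 𝓟 → Prop
    | .loop L₁ => (Pi.single L₁ 1 + Pi.single L' 1 : loops 𝓟 → ZMod 2) ∈ A
    | .component C => ∀ L₁ : loops 𝓟, ShareEdge F 𝓟 C L₁.1 →
        (Pi.single L₁ 1 + Pi.single L' 1 : loops 𝓟 → ZMod 2) ∈ A
    | .path _ => True
  suffices hQ : ∀ x y, (loopCycleGraphMinusPaths F 𝓟).Walk x y → Q y.1 → Q x.1 by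
    obtain ⟨p⟩ := h
    refine hQ _ _ p ?_
    change (Pi.single L' 1 + Pi.single L' 1 : loops 𝓟 → ZMod 2) ∈ A
    rw [ZModModule.add_self]
    exact A.zero_mem
  have step : ∀ x y : LCVertex F 𝓟, x ∉ Set.range LCVertex.path → y ∉ Set.range LCVertex.path →
      x.Incident y ∨ y.Incident x → Q y → Q x := by
    rintro (C | L₁ | P) (C' | L₂ | P') hx hy h hQ
    · exact (h.elim id id).elim
    · exact fun L₁ h₁ => htrans _ _ _ (hA C L₁ L₂ h₁ (h.resolve_left id)) hQ
    · exact absurd ⟨P', rfl⟩ hy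
    · exact hQ L₁ (h.resolve_right id)
    · exact (h.elim id id).elim
    · exact absurd ⟨P', rfl⟩ hy
    all_goals exact absurd ⟨P, rfl⟩ hx
  intro x y p hy
  induction p with
  | nil => exact hy
  | @cons x y _ hxy _ ih => exact step x.1 y.1 x.2 y.2 hxy (ih hy)

open Classical in
lemma exists_cutFactor_chain [Fintype V] (hD : (fComplement 𝓟).spanningCoe.IsCycles)
    (hB : ∀ K : (loopCycleGraphMinusPaths F 𝓟).ConnectedComponent,
      Even {x | x ∈ K.supp ∧ ∃ L : loops 𝓟, x.1 = .loop L ∧ IsThreeOdd L.1}.ncard) :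
    ∃ s ∈ edgeChains (cutFactor F 𝓟),
      (∀ v, (∀ w, ¬ (fComplement 𝓟).Adj v w) → boundary V s v = 0) ∧
      ∀ L ∈ loops 𝓟, ∑ v with v ∈ L.verts, boundary V s v = if IsThreeOdd L then 1 else 0 := by
  have hfin : Finite H.Subgraph := inferInstance
  have := Fintype.ofFinite (loops 𝓟)
  let Z : Submodule (ZMod 2) (V → ZMod 2) :=
    { carrier := {T | ∀ v, (∀ w, ¬ (fComplement 𝓟).Adj v w) → T v = 0}
      add_mem' := fun ha hb v h => by simp [ha v h, hb v h]
      zero_mem' := fun _ _ => rfl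
      smul_mem' := fun c s hs v h => by simp [hs v h] }
  -- The vectors of loop sums realized by chains on `F - E_𝓟` whose boundary vanishes off the loops.
  let A := ((edgeChains (cutFactor F 𝓟)).map (boundary V) ⊓ Z).map (loopSum 𝓟)
  suffices hmem : (fun L : loops 𝓟 => if IsThreeOdd L.1 then (1 : ZMod 2) else 0) ∈ A by
    obtain ⟨_, ⟨⟨s, hs, rfl⟩, hZ⟩, hsum⟩ := hmem
    exact ⟨s, hs, hZ, fun L hL => congrFun hsum ⟨L, hL⟩⟩
  let r : Setoid (loops 𝓟) :=
    (loopCycleGraphMinusPaths F 𝓟).reachableSetoid.comap (loopVertex F)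
  refine mem_of_sum_class_eq_zero A r
    (fun L L' h => single_add_single_mem_of_reachable (F := F) A ?_ h) _ fun L => ?_
  · intro C L L' hL hL'
    obtain ⟨a, ha, haC⟩ := exists_mem_of_shareEdge hL
    obtain ⟨b, hb, hbC⟩ := exists_mem_of_shareEdge hL'
    have hab : (cutFactor F 𝓟).Reachable a b :=
      SimpleGraph.ConnectedComponent.eq.1 (haC.trans hbC.symm)
    refine ⟨_, ⟨single_add_single_mem_map_boundary hab, fun v hv => ?_⟩, ?_⟩
    · have hva : v ≠ a := by
        rintro rfl
        obtain ⟨w, hw⟩ := loops.exists_adj L.2 ha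
        exact hv w hw
      have hvb : v ≠ b := by
        rintro rfl
        obtain ⟨w, hw⟩ := loops.exists_adj L'.2 hb
        exact hv w hw
      simp [hva, hvb]
    · ext L₁
      -- Loops are vertex-disjoint, so the path end `a` contributes to the sum of `L` only, and `b`
      -- to that of `L'` only.
      have key : ∀ (L₂ : loops 𝓟) (c : V), c ∈ L₂.1.verts → (c ∈ L₁.1.verts ↔ L₁ = L₂) :=
        fun L₂ c hc => ⟨fun h => Subtype.ext (loops.eq_of_mem_verts hD L₁.2 L₂.2 h hc),
          fun h => h ▸ hc⟩
      simp [loopSum, Finset.sum_add_distrib, Pi.single_apply, key L a ha, key L' b hb]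
  -- The class sum counts, modulo 2, the 3-odd loops in one component of `B - 𝓟`.
  · have heven := hB ((loopCycleGraphMinusPaths F 𝓟).connectedComponentMk (loopVertex F L))
    have hset : {x | x ∈ ((loopCycleGraphMinusPaths F 𝓟).connectedComponentMk
          (loopVertex F L)).supp ∧ ∃ L : loops 𝓟, x.1 = .loop L ∧ IsThreeOdd L.1} =
        loopVertex F '' {L' | r L L' ∧ IsThreeOdd L'.1} := by
      ext x
      constructor
      · rintro ⟨hx, L', hL', hodd⟩
        have hxL : loopVertex F L' = x := Subtype.ext hL'.symm
        refine ⟨L', ⟨?_, hodd⟩, hxL⟩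
        have := (SimpleGraph.ConnectedComponent.eq.1 hx).symm
        rwa [← hxL] at this
      · rintro ⟨L', ⟨hr, hodd⟩, rfl⟩
        exact ⟨SimpleGraph.ConnectedComponent.eq.2 (SimpleGraph.Reachable.symm hr), L', rfl, hodd⟩
    rw [hset, Set.ncard_image_of_injective _ loopVertex_injective,
      Set.ncard_eq_toFinset_card'] at heven
    rw [Finset.sum_ite, Finset.sum_const_zero, add_zero, Finset.sum_const, Finset.filter_filter,
      nsmul_eq_mul, mul_one]
    rw [ZMod.natCast_eq_zero_iff_even]
    convert heven using 2
    ext; simp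

end SnarkColoring

/-! ### Construction of the chain `g` on the loops, and the coloring. -/

namespace SnarkColoring

variable {V : Type*} {G F H : SimpleGraph V} {M : F.Subgraph} {𝓟 : Set H.Subgraph}

lemma hasProperAbelianColoring_of_forall {A : Type*} [AddCommGroup A] (c : Sym2 V → A)
    (h : ∀ v, ∃ x y z, IsStar G F v x y z ∧ c s(v, x) ≠ 0 ∧ c s(v, y) ≠ 0 ∧ c s(v, z) ≠ 0 ∧
      c s(v, x) ≠ c s(v, y) ∧ c s(v, x) ≠ c s(v, z) ∧ c s(v, y) ≠ c s(v, z) ∧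
      c s(v, x) + c s(v, y) + c s(v, z) = 0) : HasProperAbelianColoring G A := by
  classical
  refine ⟨SimpleGraph.Coloring.mk (fun e => c e.1) ?_, ?_, fun v => ?_⟩
  · rintro ⟨e, he⟩ ⟨e', he'⟩ hadj
    obtain ⟨hne, v, hv, hv'⟩ := SimpleGraph.lineGraph_adj_iff_exists.1 hadj
    obtain ⟨a, rfl⟩ := Sym2.mem_iff_exists.1 hv
    obtain ⟨b, rfl⟩ := Sym2.mem_iff_exists.1 hv'
    obtain ⟨x, y, z, hs, -, -, -, hxy, hxz, hyz, -⟩ := h v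
    have hab : a ≠ b := by rintro rfl; exact hne rfl
    change c s(v, a) ≠ c s(v, b)
    rcases (hs.adj_iff a).1 he with rfl | rfl | rfl <;>
      rcases (hs.adj_iff b).1 he' with rfl | rfl | rfl
    exacts [absurd rfl hab, hxy, hxz, hxy.symm, absurd rfl hab, hyz, hxz.symm, hyz.symm,
      absurd rfl hab]
  · rintro ⟨e, he⟩
    change c e ≠ 0
    induction e using Sym2.ind with
    | _ v w =>
      obtain ⟨x, y, z, hs, hx, hy, hz, -⟩ := h v
      rcases (hs.adj_iff w).1 he with rfl | rfl | rfl <;> assumption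
  · obtain ⟨x, y, z, hs, -, -, -, -, -, -, hsum⟩ := h v
    have hinc : G.incidenceSet v = ({s(v, x), s(v, y), s(v, z)} : Finset (Sym2 V)) := by
      ext e
      constructor
      · rintro ⟨he, hv⟩
        obtain ⟨a, rfl⟩ := Sym2.mem_iff_exists.1 hv
        rcases (hs.adj_iff a).1 he with rfl | rfl | rfl <;> simp
      · intro he
        simp only [Finset.coe_insert, Finset.coe_singleton, Set.mem_insert_iff,
          Set.mem_singleton_iff] at he
        rcases he with rfl | rfl | rfl
        exacts [⟨(hs.adj_iff _).2 (by simp), by simp⟩, ⟨(hs.adj_iff _).2 (by simp), by simp⟩,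
          ⟨(hs.adj_iff _).2 (by simp), by simp⟩]
    change ∑ᶠ e : G.incidenceSet v, c e.1 = 0
    have hne : ∀ a b : V, a ≠ b → s(v, a) ≠ s(v, b) := fun a b hab h => hab (Sym2.congr_right.1 h)
    rw [finsum_set_coe_eq_finsum_mem (f := c), hinc, finsum_mem_coe_finset, Finset.sum_insert,
      Finset.sum_insert, Finset.sum_singleton, ← add_assoc, hsum]
    · exact Finset.notMem_singleton.2 (hne _ _ hs.ne_yz)
    · rw [Finset.mem_insert, Finset.mem_singleton, not_or]
      exact ⟨hne _ _ hs.ne_xy, hne _ _ hs.ne_xz⟩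

/-- The boundary at a vertex of a chain supported on edges to `a` and `b`. -/
lemma boundary_eq_add [Fintype V] (s : Sym2 V → ZMod 2) {v a b : V} (hab : a ≠ b)
    (hs : ∀ w, w ≠ a → w ≠ b → s s(v, w) = 0) :
    boundary V s v = s s(v, a) + s s(v, b) := by
  classical
  rw [boundary_apply, ← Finset.sum_pair (f := fun w => s s(v, w)) hab]
  refine (Finset.sum_subset (Finset.subset_univ _) fun w _ hw => ?_).symm
  simp only [Finset.mem_insert, Finset.mem_singleton, not_or] at hw
  exact hs w hw.1 hw.2

lemma cutFactor_le : cutFactor F 𝓟 ≤ F := SimpleGraph.deleteEdges_le _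

open Classical in
/-- The chain taking the value `1 + s` on the edges of `F` on loops. -/
noncomputable def loopFactorChain (F : SimpleGraph V) (𝓟 : Set H.Subgraph) (s : Sym2 V → ZMod 2) :
    Sym2 V → ZMod 2 :=
  fun e => if e ∈ (fComplement 𝓟).edgeSet ∧ e ∈ F.edgeSet then 1 + s e else 0

open Classical in
lemma loopFactorChain_apply (s : Sym2 V → ZMod 2) (v w : V) :
    loopFactorChain F 𝓟 s s(v, w) =
      if (fComplement 𝓟).Adj v w ∧ F.Adj v w then 1 + s s(v, w) else 0 := rfl

-- At a loop vertex the zero-sum condition involves `s` on the edge of `F` off the loop. Up to the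
-- constant 1, this is the boundary of `s` plus the value of `s` on the other edge of `F`, which
-- lies on the loop. The latter term comes from a chain on the loop edges, so it cancels when summed
-- over the loop.
open Classical in
lemma exists_fComplement_chain [Fintype V] (hD : (fComplement 𝓟).spanningCoe.IsCycles)
    {s : Sym2 V → ZMod 2} (hs : ∀ L ∈ loops 𝓟,
      ∑ v with v ∈ L.verts, boundary V s v = if IsThreeOdd L then 1 else 0) :
    ∃ g ∈ edgeChains (fComplement 𝓟).spanningCoe, ∀ v w, (fComplement 𝓟).Adj v w →
      boundary V g v = (if IsKVertex H 3 v then 1 else 0) + boundary V s v +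
        boundary V (loopFactorChain F 𝓟 s) v := by
  set D := fComplement 𝓟 with hDdef
  set h := loopFactorChain F 𝓟 s with hh
  have hhD : h ∈ edgeChains D.spanningCoe := fun v w hvw => by
    rw [hh, loopFactorChain_apply, if_neg fun h => hvw h.1]
  let T : V → ZMod 2 := fun v => if ∃ w, D.Adj v w then
    (if IsKVertex H 3 v then 1 else 0) + boundary V s v + boundary V h v else 0
  suffices hT : T ∈ (edgeChains D.spanningCoe).map (boundary V) by
    obtain ⟨g, hg, hgT⟩ := hT
    exact ⟨g, hg, fun v w hvw => (congrFun hgT v).trans (if_pos ⟨w, hvw⟩)⟩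
  refine mem_map_boundary _ _ fun v => ?_
  by_cases hv : ∃ w, D.Adj v w
  · obtain ⟨w, hw⟩ := hv
    obtain ⟨L, hL, hvL⟩ := loops.exists_mem_verts hD hw
    have hfilter : Finset.univ.filter (fun w => D.spanningCoe.Reachable v w) =
        Finset.univ.filter (fun w => w ∈ L.verts) :=
      Finset.filter_congr fun w _ => (loops.mem_verts_iff hD hL hvL w).symm
    have hTL : ∀ u ∈ Finset.univ.filter (fun w => w ∈ L.verts), T u =
        (if IsKVertex H 3 u then 1 else 0) + boundary V s u + boundary V h u := fun u hu =>
      if_pos (loops.exists_adj hL (Finset.mem_filter.1 hu).2)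
    have hcount : ∑ u with u ∈ L.verts, (if IsKVertex H 3 u then (1 : ZMod 2) else 0) =
        if IsThreeOdd L then 1 else 0 := by
      rw [Finset.sum_ite, Finset.sum_const_zero, add_zero, Finset.sum_const, Finset.filter_filter,
        nsmul_eq_mul, mul_one]
      have hc : (Finset.univ.filter fun u => u ∈ L.verts ∧ IsKVertex H 3 u).card =
          {v | v ∈ L.verts ∧ IsKVertex H 3 v}.ncard := by
        rw [Set.ncard_eq_toFinset_card']
        congr 1
        ext; simp
      rw [hc]
      split_ifs with hodd
      · exact ZMod.natCast_eq_one_iff_odd.2 hodd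
      · exact ZMod.natCast_eq_zero_iff_even.2 (Nat.not_odd_iff_even.1 hodd)
    -- The count of 3-vertices cancels the boundary sum of `s`, leaving the boundary of a chain on a
    -- closed vertex set.
    rw [hfilter, Finset.sum_congr rfl hTL, Finset.sum_add_distrib, Finset.sum_add_distrib,
      hcount, hs L hL, CharTwo.add_self_eq_zero, zero_add]
    refine sum_boundary_eq_zero hhD _ fun a ha b hab => ?_
    have ha := (Finset.mem_filter.1 ha).2
    refine Finset.mem_filter.2 ⟨Finset.mem_univ _, ?_⟩
    exact ((loops.adj_iff hD hL ha b).2 hab).snd_mem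
  · refine Finset.sum_eq_zero fun u hu => ?_
    obtain ⟨p⟩ := (Finset.mem_filter.1 hu).2
    cases p with
    | nil => exact if_neg hv
    | cons hadj _ => exact absurd ⟨_, hadj⟩ hv

/-- The embedding of `ZMod 2` into `ZMod 4`. -/
def double (t : ZMod 2) : ZMod 4 := if t = 0 then 0 else 2

/-- The first coordinates sum to `2 + 2(a + b + c)`, whence the condition on `a + b + c`; the
parities alone make the colors distinct and non-zero. -/
lemma double_loop_values : ∀ a b c : ZMod 2, a + b = c + 1 →
    ((double c, 1) : ZMod 4 × ZMod 2) ≠ 0 ∧ ((1 + double a, 1) : ZMod 4 × ZMod 2) ≠ 0 ∧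
    ((1 + double b, 0) : ZMod 4 × ZMod 2) ≠ 0 ∧
    ((double c, 1) : ZMod 4 × ZMod 2) ≠ (1 + double a, 1) ∧
    ((double c, 1) : ZMod 4 × ZMod 2) ≠ (1 + double b, 0) ∧
    ((1 + double a, 1) : ZMod 4 × ZMod 2) ≠ (1 + double b, 0) ∧
    ((double c, 1) : ZMod 4 × ZMod 2) + (1 + double a, 1) + (1 + double b, 0) = 0 := by
  intro a b c h
  refine ⟨?_, ?_, ?_, ?_, ?_, ?_, ?_⟩ <;> revert a b c <;> decide

/-- The shift by 1 on the path edge in `F` both compensates the color `(2, 0)` and separates the two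
edges of `F`, where `s` takes equal values. -/
lemma double_path_values : ∀ a b : ZMod 2, a + b = 0 →
    ((double a, 1) : ZMod 4 × ZMod 2) ≠ 0 ∧ ((double (b + 1), 1) : ZMod 4 × ZMod 2) ≠ 0 ∧
    ((2, 0) : ZMod 4 × ZMod 2) ≠ 0 ∧
    ((double a, 1) : ZMod 4 × ZMod 2) ≠ (double (b + 1), 1) ∧
    ((double a, 1) : ZMod 4 × ZMod 2) ≠ (2, 0) ∧
    ((double (b + 1), 1) : ZMod 4 × ZMod 2) ≠ (2, 0) ∧
    ((double a, 1) : ZMod 4 × ZMod 2) + (double (b + 1), 1) + (2, 0) = 0 := by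
  intro a b h
  refine ⟨?_, ?_, ?_, ?_, ?_, ?_, ?_⟩ <;> revert a b <;> decide

open Classical in
/-- The edge coloring given by the chains `s` and `g`. -/
noncomputable def chainColoring (F : SimpleGraph V) (𝓟 : Set H.Subgraph) (s g : Sym2 V → ZMod 2) (e : Sym2 V) :
    ZMod 4 × ZMod 2 :=
  (if e ∈ (fComplement 𝓟).edgeSet then 1 + double (g e)
    else if e ∈ F.edgeSet then double (s e + if e ∈ H.edgeSet then 1 else 0) else 2,
    if e ∈ F.edgeSet then 1 else 0)

section

variable (s g : Sym2 V → ZMod 2) {v w : V}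

lemma chainColoring_of_loop_of_factor (h : (fComplement 𝓟).Adj v w) (hF : F.Adj v w) :
    chainColoring F 𝓟 s g s(v, w) = (1 + double (g s(v, w)), 1) := by
  simp [chainColoring, h, hF]

lemma chainColoring_of_loop_of_not_factor (h : (fComplement 𝓟).Adj v w) (hF : ¬ F.Adj v w) :
    chainColoring F 𝓟 s g s(v, w) = (1 + double (g s(v, w)), 0) := by
  simp [chainColoring, h, hF]

lemma chainColoring_of_path_of_factor (h : ¬ (fComplement 𝓟).Adj v w) (hH : H.Adj v w)
    (hF : F.Adj v w) : chainColoring F 𝓟 s g s(v, w) = (double (s s(v, w) + 1), 1) := by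
  simp [chainColoring, h, hF, hH]

lemma chainColoring_of_path_of_not_factor (h : ¬ (fComplement 𝓟).Adj v w) (hF : ¬ F.Adj v w) :
    chainColoring F 𝓟 s g s(v, w) = (2, 0) := by
  simp [chainColoring, h, hF]

lemma chainColoring_of_matching (hH : ¬ H.Adj v w) (hF : F.Adj v w) :
    chainColoring F 𝓟 s g s(v, w) = (double (s s(v, w)), 1) := by
  have h : ¬ (fComplement 𝓟).Adj v w := fun h => hH h.1
  simp [chainColoring, h, hF, hH]

end

theorem hasProperAbelianColoring_of_even_threeOdd [Finite V] (hG : IsRegular G 3)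
    (hF : IsTwoFactor G F) (hM : M.IsMatching)
    (hH : ∀ v w, H.Adj v w ↔ G.Adj v w ∧ ¬ M.Adj v w) (h𝓟 : IsFMatching F 𝓟)
    (hB : ∀ K : (loopCycleGraphMinusPaths F 𝓟).ConnectedComponent,
      Even {x | x ∈ K.supp ∧ ∃ L : loops 𝓟, x.1 = .loop L ∧ IsThreeOdd L.1}.ncard) :
    HasProperAbelianColoring G (ZMod 4 × ZMod 2) := by
  classical
  have := Fintype.ofFinite V
  have hD := isCycles_fComplement hG hF hM hH h𝓟
  obtain ⟨s, hsK, hs0, hsL⟩ := exists_cutFactor_chain hD hB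
  obtain ⟨g, hgD, hg⟩ := exists_fComplement_chain (F := F) hD hsL
  refine hasProperAbelianColoring_of_forall (F := F) (chainColoring F 𝓟 s g) fun v => ?_
  obtain ⟨x, y, z, hst, hv⟩ := exists_isStar_cases hG hF hM hH h𝓟 v
  refine ⟨x, y, z, hst, ?_⟩
  have hFx : F.Adj v x := (hst.factor_adj_iff x).2 (Or.inl rfl)
  have hFy : F.Adj v y := (hst.factor_adj_iff y).2 (Or.inr rfl)
  have hFz : ¬ F.Adj v z := fun h =>
    ((hst.factor_adj_iff z).1 h).elim hst.ne_xz.symm hst.ne_yz.symm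
  have hbs : boundary V s v = s s(v, x) + s s(v, y) :=
    boundary_eq_add s hst.ne_xy fun w hx hy => hsK v w fun h =>
      ((hst.factor_adj_iff w).1 (cutFactor_le h)).elim hx hy
  have hloop : (∀ w, (fComplement 𝓟).Adj v w ↔ w = y ∨ w = z) →
      g s(v, y) + g s(v, z) = (if IsKVertex H 3 v then 1 else 0) + s s(v, x) + 1 := by
    intro hv
    have hx : ¬ (fComplement 𝓟).Adj v x := fun h =>
      ((hv x).1 h).elim hst.ne_xy hst.ne_xz
    have hy : (fComplement 𝓟).Adj v y := (hv y).2 (Or.inl rfl)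
    have hbg : boundary V g v = g s(v, y) + g s(v, z) :=
      boundary_eq_add g hst.ne_yz fun w hy hz => hgD v w fun h => ((hv w).1 h).elim hy hz
    have hbh : boundary V (loopFactorChain F 𝓟 s) v = 1 + s s(v, y) := by
      rw [boundary_eq_add _ hst.ne_xy fun w hx hy => ?_, loopFactorChain_apply,
        loopFactorChain_apply, if_neg fun h => hx h.1, if_pos ⟨hy, hFy⟩, zero_add]
      rw [loopFactorChain_apply]
      exact if_neg fun h => ((hst.factor_adj_iff w).1 h.2).elim hx hy
    rw [← hbg, hg v y hy, hbh, hbs]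
    -- The value on the loop edge `s(v, y)` enters through both boundaries and cancels.
    have := CharTwo.add_self_eq_zero (s s(v, y))
    linear_combination this
  rcases hv with ⟨h3, hHx, hv, hKx⟩ | ⟨h3, hHx, hv⟩ | ⟨hv, hHx, hHy, hHz⟩
  · have hl := hloop hv
    -- The 3-vertex term is the shift by 1 that the end-edge `s(v, x)` receives for lying in `H`; an
    -- edge of `M` receives none.
    rw [if_pos h3, add_comm 1] at hl
    have hx : ¬ (fComplement 𝓟).Adj v x := fun h =>
      ((hv x).1 h).elim hst.ne_xy hst.ne_xz
    rw [chainColoring_of_path_of_factor s g hx hHx hFx,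
      chainColoring_of_loop_of_factor s g ((hv y).2 (Or.inl rfl)) hFy,
      chainColoring_of_loop_of_not_factor s g ((hv z).2 (Or.inr rfl)) hFz]
    exact double_loop_values _ _ _ hl
  · have hl := hloop hv
    rw [if_neg h3, zero_add] at hl
    rw [chainColoring_of_matching s g hHx hFx,
      chainColoring_of_loop_of_factor s g ((hv y).2 (Or.inl rfl)) hFy,
      chainColoring_of_loop_of_not_factor s g ((hv z).2 (Or.inr rfl)) hFz]
    exact double_loop_values _ _ _ hl
  · have hb : s s(v, x) + s s(v, y) = 0 := by rw [← hbs, hs0 v hv]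
    rw [chainColoring_of_matching s g hHx hFx, chainColoring_of_path_of_factor s g (hv y) hHy hFy,
      chainColoring_of_path_of_not_factor s g (hv z) hFz]
    exact double_path_values _ _ hb

end SnarkColoring

theorem mainTheorem2 {V : Type*} [Finite V] (G : SimpleGraph V) (hG : SnarkColoring.IsSnark G)
    (F : SimpleGraph V) (hF : SnarkColoring.IsTwoFactor G F)
    (M : F.Subgraph) (hM : M.IsMatching)
    (𝓟 : Set (G.deleteEdges M.edgeSet).Subgraph) (h𝓟 : SnarkColoring.IsFMatching F 𝓟)
    (hB : ∀ K : (SnarkColoring.loopCycleGraphMinusPaths F 𝓟).ConnectedComponent,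
      Even {x | x ∈ K.supp ∧
        ∃ L : SnarkColoring.loops 𝓟, x.1 = .loop L ∧ SnarkColoring.IsThreeOdd L.1}.ncard) :
    SnarkColoring.HasProperAbelianColoring G (ZMod 4 × ZMod 2) :=
  SnarkColoring.hasProperAbelianColoring_of_even_threeOdd hG.cubic hF hM
    (fun v w => by simp [SimpleGraph.deleteEdges_adj]) h𝓟 hB
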